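/- **Theorem (uniqueness of the channel KL-relative entropy).** For finite non-empty sets $X,Y$, a classical channel $\mathcal M\in\mathrm{CPTP}(X\to Y)$ is a stochastic map: it assigns to every $x\in X$ a probability vector $\mathcal M(|x\rangle\langle x|)$ on $Y$; probability vectors on $Y$ (classical states) are identified with the channels in $\mathrm{CPTP}(1\to Y)$, where $1$ is the one-point system. Let $\mathbb D$ be a function that assigns to every pair of classical channels $\mathcal M,\mathcal N\in\mathrm{CPTP}(X\to Y)$, for all finite $X,Y$, a value $\mathbb D(\mathcal M\|\mathcal N)\in\mathbb R\cup\{\infty\}$, such that 1. ($\mathbb D$ is a classical channel divergence) $\mathbb D(\Theta[\mathcal M]\|\Theta[\mathcal N])\le\mathbb D(\mathcal M\|\mathcal N)$ for all $\mathcal M,\mathcal N\in\mathrm{CPTP}(X\to Y)$ and every superchannel $\Theta[\mathcal M]=\mathcal F\circ(\mathcal M\otimes\mathrm{id}_R)\circ\mathcal E$ with a finite reference system $R$ and classical channels $\mathcal E\in\mathrm{CPTP}(X'\to XR)$, $\mathcal F\in\mathrm{CPTP}(YR\to Y')$; 2. ($\mathbb D$ is weakly additive) $\mathbb D(\mathcal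 M^{\otimes k}\|\mathcal N^{\otimes k})=k\,\mathbb D(\mathcal M\|\mathcal N)$ for all $\mathcal M,\mathcal N\in\mathrm{CPTP}(X\to Y)$ and all integers $k\ge1$ (this holds in particular if $\mathbb D$ is additive under tensor products, i.e. if $\mathbb D$ is a channel relative entropy); 3. ($\mathbb D$ reduces to the Kullback–Leibler divergence on classical states) $\mathbb D(\mathbf p\|\mathbf q)=D(\mathbf p\|\mathbf q)$ for all probability vectors $\mathbf p,\mathbf q$ on the same finite set, where $D(\mathbf p\|\mathbf q)=\sum_y p_y\log_2(p_y/q_y)$ (with $0\log_2(0/q)=0$) if $q_y=0$ implies $p_y=0$ for all $y$, and $D(\mathbf p\|\mathbf q)=\infty$ otherwise; 4. ($\mathbb D$ is continuous in its second argument) for every $\mathcal M\in\mathrm{CPTP}(X\to Y)$ the map $\mathcal N\mapsto\mathbb D(\mathcal M\|\mathcal N)$ from $\mathrm{CPTP}(X\to Y)$ to the extended real line is continuous. Then for all finite non-empty sets $X,Y$ and all classical channels $\mathcal M,\mathcal N\in\mathrm{CPTP}(X\to Y)$ $$\mathbb D(\mathcal M\|\mathcal N)=\max_{x\in X}D\big(\mathcal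 M(|x\rangle\langle x|)\,\big\|\,\mathcal N(|x\rangle\langle x|)\big).$$ -/

import Mathlib

open Finset

namespace ClassicalChannel

/-- A classical channel from `X` to `Y`, i.e. a stochastic map: `M x` is the output distribution
`M(|x⟩⟨x|)`, and `M x y` is the transition probability `M(y|x)`. The topology is that of the
transition probabilities. -/
abbrev Channel (X Y : Type) [Fintype Y] : Type := X → stdSimplex ℝ Y

/-- A classical state (probability vector) as a channel whose input system is trivial. -/
def ofState {Y : Type} [Fintype Y] (p : stdSimplex ℝ Y) : Channel Unit Y := fun _ => p

/-- The action on `M` of the superchannel with pre-processing `E : X' → X ⊗ R`, reference system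
`R` and post-processing `F : Y ⊗ R → Y'`, i.e. `F ∘ (M ⊗ id_R) ∘ E`. -/
def superchannel {X Y X' Y' R : Type} [Fintype X] [Fintype Y] [Fintype Y'] [Fintype R]
    (E : Channel X' (X × R)) (F : Channel (Y × R) Y') (M : Channel X Y) : Channel X' Y' :=
  fun x' => ⟨fun y' => ∑ x, ∑ r, ∑ y, (E x').1 (x, r) * (M x).1 y * (F (y, r)).1 y', by
    refine ⟨fun y' => ?_, ?_⟩
    · exact sum_nonneg fun x _ => sum_nonneg fun r _ => sum_nonneg fun y _ =>
        mul_nonneg (mul_nonneg ((E x').2.1 _) ((M x).2.1 _)) ((F (y, r)).2.1 _)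
    · rw [sum_comm]
      have h : ∀ x, ∑ y', ∑ r, ∑ y, (E x').1 (x, r) * (M x).1 y * (F (y, r)).1 y'
          = ∑ r, (E x').1 (x, r) := by
        intro x
        rw [sum_comm]
        refine sum_congr rfl fun r _ => ?_
        rw [sum_comm]
        simp_rw [← mul_sum, fun y => (F (y, r)).2.2, mul_one, ← mul_sum, (M x).2.2, mul_one]
      simp_rw [h]
      rw [← Fintype.sum_prod_type']
      exact (E x').2.2⟩

/-- The `k`-fold tensor power of a channel. -/
def tensorPower {X Y : Type} [Fintype Y] (M : Channel X Y) (k : ℕ) :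
    Channel (Fin k → X) (Fin k → Y) :=
  fun x => ⟨fun y => ∏ i, (M (x i)).1 (y i), by
    classical
    refine ⟨fun y => prod_nonneg fun i _ => (M (x i)).2.1 _, ?_⟩
    rw [← Fintype.prod_sum (fun i y => (M (x i)).1 y)]
    exact prod_eq_one fun i _ => (M (x i)).2.2⟩

/-- The Kullback–Leibler divergence in bits, `∑ p log₂ (p / q)` if `p ≪ q` and `∞` otherwise. -/
noncomputable def klDivergence {Y : Type} [Fintype Y] (p q : stdSimplex ℝ Y) : EReal :=
  open Classical in
  if ∀ y, q.1 y = 0 → p.1 y = 0 then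
    ((∑ y, p.1 y * Real.logb 2 (p.1 y / q.1 y) : ℝ) : EReal)
  else ⊤

/-- A function of pairs of classical channels with the same input and output systems, over all
finite (nonzero-dimensional) systems. -/
abbrev ChannelFunction : Type 1 :=
  ∀ (X Y : Type) [Fintype X] [Nonempty X] [Fintype Y] [Nonempty Y],
    Channel X Y → Channel X Y → EReal

/-- Classical channel divergences: functions with values in `ℝ ∪ {∞}` that satisfy the data
processing inequality under all superchannels. -/
structure IsChannelDivergence (D : ChannelFunction) : Prop where
  ne_bot : ∀ (X Y : Type) [Fintype X] [Nonempty X] [Fintype Y] [Nonempty Y]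
    (M N : Channel X Y), D X Y M N ≠ ⊥
  dpi : ∀ (X Y X' Y' R : Type) [Fintype X] [Nonempty X] [Fintype Y] [Nonempty Y]
    [Fintype X'] [Nonempty X'] [Fintype Y'] [Nonempty Y'] [Fintype R]
    (E : Channel X' (X × R)) (F : Channel (Y × R) Y') (M N : Channel X Y),
    D X' Y' (superchannel E F M) (superchannel E F N) ≤ D X Y M N

/-- Additivity on tensor powers. -/
def IsWeaklyAdditive (D : ChannelFunction) : Prop :=
  ∀ (X Y : Type) [Fintype X] [Nonempty X] [Fintype Y] [Nonempty Y]
    (M N : Channel X Y) (k : ℕ), 1 ≤ k →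
    D (Fin k → X) (Fin k → Y) (tensorPower M k) (tensorPower N k) = (k : EReal) * D X Y M N

/-- `D` agrees with the Kullback–Leibler divergence on classical states. -/
def ReducesToKL (D : ChannelFunction) : Prop :=
  ∀ (Y : Type) [Fintype Y] [Nonempty Y] (p q : stdSimplex ℝ Y),
    D Unit Y (ofState p) (ofState q) = klDivergence p q

/-- Continuity in the second argument, as a function with values in the extended reals. -/
def IsContinuousInSecond (D : ChannelFunction) : Prop :=
  ∀ (X Y : Type) [Fintype X] [Nonempty X] [Fintype Y] [Nonempty Y] (M : Channel X Y),
    Continuous fun N : Channel X Y => D X Y M N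

end ClassicalChannel

open Finset Filter Topology

namespace ClassicalChannel

/-! Lower bound: feeding a fixed input `x` to both channels is a superchannel, so data processing
gives `D(M x ‖ N x) ≤ 𝔻(M ‖ N)`. Upper bound: if two states `p`, `q` become `M x`, `N x` under a
common processing that may depend on `x`, then `𝔻(M ‖ N) ≤ D(p ‖ q)` (`le_klDivergence`). This is
applied to tensor powers. When every output divergence is below `t`, a Chernoff bound shows that,
uniformly in the input, the likelihood ratio of the `n`-th powers exceeds `2 ^ (n (t + δ))` with
vanishing probability; it never exceeds `b ^ n`. Splitting the power of `M` into a typical part and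
a rest of weight `ε` yields a simulation from a pair of three-point states with divergence at most
`n (t + δ) + ε n log₂ b + O(1)` (`le_of_tail`). Weak additivity removes the factor `n`; then `n → ∞`
and `δ, ε → 0`. -/

/-- The point mass at `a`. -/
noncomputable def dirac {A : Type} [Fintype A] (a : A) : stdSimplex ℝ A :=
  open Classical in ⟨Pi.single a 1, single_mem_stdSimplex ℝ a⟩

lemma sum_dirac_mul {A : Type} [Fintype A] (a : A) (f : A → ℝ) :
    ∑ b, (dirac a).1 b * f b = f a := by
  classical
  simp [dirac, Pi.single_apply]

lemma sum_mul_dirac {A : Type} [Fintype A] (a : A) (f : A → ℝ) :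
    ∑ b, f b * (dirac b).1 a = f a := by
  classical
  simp [dirac, Pi.single_apply]

/-! ### Comparison with states by data processing -/

/-- A channel divergence dominates the divergence of the outputs at every input. -/
lemma IsChannelDivergence.klDivergence_le {D : ChannelFunction} (hdiv : IsChannelDivergence D)
    (hKL : ReducesToKL D) {X Y : Type} [Fintype X] [Nonempty X] [Fintype Y] [Nonempty Y]
    (M N : Channel X Y) (x : X) : klDivergence (M x) (N x) ≤ D X Y M N := by
  have key : ∀ L : Channel X Y,
      superchannel (fun _ : Unit => dirac (x, ())) (fun y : Y × Unit => dirac y.1) L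
        = ofState (L x) := by
    intro L
    funext u
    apply Subtype.ext
    funext y'
    change ∑ x₁, ∑ r, ∑ y, (dirac (x, ())).1 (x₁, r) * (L x₁).1 y * (dirac y).1 y' = (L x).1 y'
    simp_rw [sum_mul_dirac y' (fun y => (dirac (x, ())).1 (_, _) * (L _).1 y)]
    rw [← Fintype.sum_prod_type' (fun x₁ r => (dirac (x, ())).1 (x₁, r) * (L x₁).1 y')]
    exact sum_dirac_mul (x, ()) (fun z => (L z.1).1 y')
  have h := hdiv.dpi X Y Unit Y Unit (fun _ => dirac (x, ())) (fun y => dirac y.1) M N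
  rwa [key, key, hKL] at h

/-- If a pair of states can be processed into the outputs of a pair of channels, by a processing
that depends on the input, then its divergence dominates the channel divergence. -/
lemma IsChannelDivergence.le_klDivergence {D : ChannelFunction} (hdiv : IsChannelDivergence D)
    (hKL : ReducesToKL D) {X Y Z : Type} [Fintype X] [Nonempty X] [Fintype Y] [Nonempty Y]
    [Fintype Z] [Nonempty Z] (M N : Channel X Y) (p q : stdSimplex ℝ Z) (F : X → Channel Z Y)
    (hM : ∀ x y, ∑ z, p.1 z * (F x z).1 y = (M x).1 y)
    (hN : ∀ x y, ∑ z, q.1 z * (F x z).1 y = (N x).1 y) :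
    D X Y M N ≤ klDivergence p q := by
  -- The pre-processing stores the input in the reference system, where the post-processing can read
  -- it.
  have key : ∀ (L : Channel X Y) (l : stdSimplex ℝ Z),
      (∀ x y, ∑ z, l.1 z * (F x z).1 y = (L x).1 y) →
      superchannel (fun x : X => dirac ((), x)) (fun z : Z × X => F z.2 z.1) (ofState l) = L := by
    intro L l hl
    funext x
    apply Subtype.ext
    funext y
    change ∑ u, ∑ r, ∑ z, (dirac ((), x)).1 (u, r) * l.1 z * (F r z).1 y = (L x).1 y
    simp_rw [mul_assoc, ← mul_sum, hl]
    rw [← Fintype.sum_prod_type' (fun u r => (dirac ((), x)).1 (u, r) * (L r).1 y)]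
    exact sum_dirac_mul ((), x) (fun z => (L z.2).1 y)
  have h := hdiv.dpi Unit Z X Y X (fun x => dirac ((), x)) (fun z => F z.2 z.1)
    (ofState p) (ofState q)
  rwa [key M p hM, key N q hN, hKL] at h

/-! ### Simulation by three-point states -/

/-- If `M` has a part `A` of weight `1 - ε` dominated by `a • N`, and is itself dominated by
`b • N`, then its divergence from `N` is essentially at most `log₂ a + ε log₂ b`. -/
lemma IsChannelDivergence.le_of_domination {D : ChannelFunction} (hdiv : IsChannelDivergence D)
    (hKL : ReducesToKL D) {X Y : Type} [Fintype X] [Nonempty X] [Fintype Y] [Nonempty Y]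
    (M N A : Channel X Y) {ε a b : ℝ} (hε : 0 < ε) (hε1 : ε < 1) (ha : 0 < a) (hb : 0 < b)
    (hAM : ∀ x y, (1 - ε) * (A x).1 y ≤ (M x).1 y)
    (hAN : ∀ x y, (A x).1 y ≤ a * (N x).1 y)
    (hMN : ∀ x y, (M x).1 y ≤ b * (N x).1 y) :
    D X Y M N ≤ ((Real.logb 2 (4 * a) + ε * Real.logb 2 (4 * b) : ℝ) : EReal) := by
  have hε1' : 0 < 1 - ε := by linarith
  -- The normalised rest of `M`: `M = (1 - ε) A + ε B`.
  let B : Channel X Y := fun x => ⟨fun y => ((M x).1 y - (1 - ε) * (A x).1 y) / ε,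
    fun y => div_nonneg (sub_nonneg.2 (hAM x y)) hε.le, by
      rw [← sum_div, sum_sub_distrib, ← mul_sum, (M x).2.2, (A x).2.2]
      field_simp
      ring⟩
  have hBε : ∀ x y, ε * (B x).1 y = (M x).1 y - (1 - ε) * (A x).1 y := fun x y =>
    mul_div_cancel₀ _ hε.ne'
  set q₀ : ℝ := 1 / (4 * a) with hq₀
  set q₁ : ℝ := ε / (4 * b) with hq₁
  have hq₀0 : 0 < q₀ := by positivity
  have hq₁0 : 0 < q₁ := by positivity
  have hdom : ∀ x y, q₀ * (A x).1 y + q₁ * (B x).1 y ≤ (N x).1 y / 2 := by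
    intro x y
    have h1 : q₀ * (A x).1 y ≤ (N x).1 y / 4 := by
      calc q₀ * (A x).1 y ≤ q₀ * (a * (N x).1 y) := mul_le_mul_of_nonneg_left (hAN x y) hq₀0.le
        _ = (N x).1 y / 4 := by rw [hq₀]; field_simp
    have h2 : q₁ * (B x).1 y ≤ (N x).1 y / 4 := by
      have h3 : ε * (B x).1 y ≤ b * (N x).1 y := by
        have := mul_nonneg hε1'.le ((A x).2.1 y)
        rw [hBε]; linarith [hMN x y]
      calc q₁ * (B x).1 y = (ε * (B x).1 y) / (4 * b) := by rw [hq₁]; ring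
        _ ≤ (b * (N x).1 y) / (4 * b) := by gcongr
        _ = (N x).1 y / 4 := by field_simp
    linarith
  have hq : q₀ + q₁ ≤ 1 / 2 := by
    obtain ⟨x⟩ := ‹Nonempty X›
    have := sum_le_sum fun y (_ : y ∈ univ) => hdom x y
    rwa [sum_add_distrib, ← mul_sum, ← mul_sum, (A x).2.2, (B x).2.2, ← sum_div, (N x).2.2,
      mul_one, mul_one] at this
  set q₂ : ℝ := 1 - q₀ - q₁ with hq₂
  have hq₂0 : 0 < q₂ := by linarith
  let G : Channel X Y := fun x =>
    ⟨fun y => ((N x).1 y - q₀ * (A x).1 y - q₁ * (B x).1 y) / q₂,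
      fun y => div_nonneg (by linarith [hdom x y, (N x).2.1 y]) hq₂0.le, by
      rw [← sum_div, sum_sub_distrib, sum_sub_distrib, ← mul_sum, ← mul_sum, (N x).2.2,
        (A x).2.2, (B x).2.2, mul_one, mul_one]
      exact div_self hq₂0.ne'⟩
  have hG : ∀ x y, q₂ * (G x).1 y = (N x).1 y - q₀ * (A x).1 y - q₁ * (B x).1 y := fun x y =>
    mul_div_cancel₀ _ hq₂0.ne'
  let p : stdSimplex ℝ (Fin 3) := ⟨![1 - ε, ε, 0], by
    intro i; fin_cases i
    · exact hε1'.le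
    · exact hε.le
    · exact le_rfl, by simp [Fin.sum_univ_three]⟩
  let q : stdSimplex ℝ (Fin 3) := ⟨![q₀, q₁, q₂], by
    intro i; fin_cases i
    · exact hq₀0.le
    · exact hq₁0.le
    · exact hq₂0.le, by simp [Fin.sum_univ_three, hq₂]⟩
  refine (hdiv.le_klDivergence hKL M N p q (fun x => ![A x, B x, G x]) ?_ ?_).trans ?_
  · intro x y
    simp [Fin.sum_univ_three, p, hBε]
  · intro x y
    simp [Fin.sum_univ_three, q, hG]
  · have hac : ∀ i, q.1 i = 0 → p.1 i = 0 := by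
      intro i; fin_cases i
      · intro h; exact absurd h hq₀0.ne'
      · intro h; exact absurd h hq₁0.ne'
      · intro h; rfl
    rw [klDivergence, if_pos hac, EReal.coe_le_coe_iff]
    have e0 : (1 - ε) / q₀ = 4 * a * (1 - ε) := by rw [hq₀]; field_simp
    have e1 : ε / q₁ = 4 * b := by rw [hq₁]; field_simp
    have e2 : ∑ i, p.1 i * Real.logb 2 (p.1 i / q.1 i)
        = (1 - ε) * Real.logb 2 (4 * a * (1 - ε)) + ε * Real.logb 2 (4 * b) := by
      rw [← e0, ← e1]; simp [Fin.sum_univ_three, p, q]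
    -- Makes `log₂ (4 a)` nonnegative, so that its prefactor `1 - ε` can be dropped.
    have ha4 : 1 ≤ 4 * a := by
      have : q₀ ≤ 1 := by linarith
      rwa [hq₀, div_le_one (by positivity)] at this
    have h1 : Real.logb 2 (4 * a * (1 - ε)) ≤ Real.logb 2 (4 * a) :=
      Real.logb_le_logb_of_le (by norm_num) (by positivity) (by nlinarith)
    have h2 : 0 ≤ Real.logb 2 (4 * a) := Real.logb_nonneg (by norm_num) ha4
    rw [e2]
    nlinarith

/-- If the likelihood ratio of `M` and `N` exceeds `c` with probability at most `ε` under `M`, and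
never exceeds `b`, then the divergence is essentially at most `log₂ c + ε log₂ b`. -/
lemma IsChannelDivergence.le_of_tail {D : ChannelFunction} (hdiv : IsChannelDivergence D)
    (hKL : ReducesToKL D) {X Y : Type} [Fintype X] [Nonempty X] [Fintype Y] [Nonempty Y]
    (M N : Channel X Y) {ε b c : ℝ} (hε : 0 < ε) (hε1 : ε ≤ 1 / 2) (hb : 0 < b) (hc : 0 < c)
    (hMN : ∀ x y, (M x).1 y ≤ b * (N x).1 y)
    (htail : ∀ x, ∑ y with c * (N x).1 y < (M x).1 y, (M x).1 y ≤ ε) :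
    D X Y M N ≤ ((Real.logb 2 (8 * c) + ε * Real.logb 2 (4 * b) : ℝ) : EReal) := by
  have hm : ∀ x, 1 - ε ≤ ∑ y with ¬ c * (N x).1 y < (M x).1 y, (M x).1 y := by
    intro x
    have h := sum_filter_add_sum_filter_not univ (fun y => c * (N x).1 y < (M x).1 y)
      (fun y => (M x).1 y)
    rw [(M x).2.2] at h
    linarith [htail x]
  have hm0 : ∀ x, 0 < ∑ y with ¬ c * (N x).1 y < (M x).1 y, (M x).1 y := fun x => by
    linarith [hm x]
  -- `M` conditioned on likelihood ratio at most `c`. The conditioning event has mass at least `1 /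
  -- 2`, whence `A ≤ 2 c N`.
  let A : Channel X Y := fun x =>
    ⟨fun y => (if ¬ c * (N x).1 y < (M x).1 y then (M x).1 y else 0) /
        ∑ y with ¬ c * (N x).1 y < (M x).1 y, (M x).1 y, by
      intro y
      refine div_nonneg ?_ (hm0 x).le
      split_ifs
      exacts [le_rfl, (M x).2.1 y], by
      rw [← sum_div, ← sum_filter]
      exact div_self (hm0 x).ne'⟩
  have h8 : 8 * c = 4 * (2 * c) := by ring
  rw [h8]
  refine hdiv.le_of_domination hKL M N A hε (by linarith) (by positivity) hb ?_ ?_ hMN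
  · intro x y
    change (1 - ε) * ((if ¬ c * (N x).1 y < (M x).1 y then (M x).1 y else 0) / _) ≤ _
    rw [← mul_div_assoc, div_le_iff₀ (hm0 x), mul_comm]
    have h0 := (M x).2.1 y
    refine mul_le_mul ?_ (hm x) (by linarith) h0
    split_ifs
    exacts [h0, le_rfl]
  · intro x y
    change (if ¬ c * (N x).1 y < (M x).1 y then (M x).1 y else 0) / _ ≤ _
    rw [div_le_iff₀ (hm0 x)]
    have h0 : 0 ≤ c * (N x).1 y := mul_nonneg hc.le ((N x).2.1 y)
    have h1 : c * (N x).1 y ≤ 2 * c * (N x).1 y *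
        ∑ y with ¬ c * (N x).1 y < (M x).1 y, (M x).1 y := by
      nlinarith [hm x]
    refine le_trans ?_ h1
    split_ifs with h
    exacts [h0, not_lt.1 h]

/-! ### Moments of the likelihood ratio -/

/-- The Chernoff bound for the likelihood ratio of tensor powers. -/
lemma tail_tensorPower_le {X Y : Type} [Fintype Y] (M N : Channel X Y)
    (hac : ∀ x y, (N x).1 y = 0 → (M x).1 y = 0) {s c g : ℝ} (hs : 0 < s) (hc : 0 < c)
    (hg : ∀ x, ∑ y, (M x).1 y * ((M x).1 y / (N x).1 y) ^ s ≤ g) (n : ℕ) (x : Fin n → X) :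
    ∑ y with c * (tensorPower N n x).1 y < (tensorPower M n x).1 y, (tensorPower M n x).1 y
      ≤ g ^ n / c ^ s := by
  classical
  have hr : ∀ x y, 0 ≤ (M x).1 y / (N x).1 y := fun x y => div_nonneg ((M x).2.1 y) ((N x).2.1 y)
  have hcs : 0 < c ^ s := Real.rpow_pos_of_pos hc s
  have hpos : ∀ y, 0 ≤ (tensorPower M n x).1 y * (∏ i, (M (x i)).1 (y i) / (N (x i)).1 (y i)) ^ s :=
    fun y => mul_nonneg ((tensorPower M n x).2.1 y)
      (Real.rpow_nonneg (prod_nonneg fun i _ => hr _ _) _)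
  rw [le_div_iff₀ hcs, sum_mul]
  calc ∑ y with c * (tensorPower N n x).1 y < (tensorPower M n x).1 y,
        (tensorPower M n x).1 y * c ^ s
      ≤ ∑ y with c * (tensorPower N n x).1 y < (tensorPower M n x).1 y,
        (tensorPower M n x).1 y * (∏ i, (M (x i)).1 (y i) / (N (x i)).1 (y i)) ^ s := by
        -- Markov's inequality for the `s`-th power: on the tail event the ratio is at least `c`.
        refine sum_le_sum fun y hy => ?_
        refine mul_le_mul_of_nonneg_left ?_ ((tensorPower M n x).2.1 y)
        refine Real.rpow_le_rpow hc.le ?_ hs.le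
        have hy' : c * ∏ i, (N (x i)).1 (y i) < ∏ i, (M (x i)).1 (y i) := (mem_filter.1 hy).2
        have hNnn : 0 ≤ ∏ i, (N (x i)).1 (y i) := prod_nonneg fun i _ => (N (x i)).2.1 _
        have hM0 : 0 < ∏ i, (M (x i)).1 (y i) := (mul_nonneg hc.le hNnn).trans_lt hy'
        have hN0 : 0 < ∏ i, (N (x i)).1 (y i) := by
          refine lt_of_le_of_ne hNnn fun h => ?_
          obtain ⟨i, hi, h0⟩ := prod_eq_zero_iff.1 h.symm
          exact hM0.ne' (prod_eq_zero hi (hac _ _ h0))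
        rw [prod_div_distrib, le_div_iff₀ hN0]
        exact hy'.le
    _ ≤ ∑ y, (tensorPower M n x).1 y * (∏ i, (M (x i)).1 (y i) / (N (x i)).1 (y i)) ^ s :=
        sum_le_sum_of_subset_of_nonneg (filter_subset _ _) fun y _ _ => hpos y
    _ = ∑ y : Fin n → Y, ∏ i, ((M (x i)).1 (y i) * ((M (x i)).1 (y i) / (N (x i)).1 (y i)) ^ s) := by
        refine sum_congr rfl fun y _ => ?_
        rw [prod_mul_distrib, Real.finsetProd_rpow _ _ fun i _ => hr _ _]
        rfl
    _ = ∏ i, ∑ y, (M (x i)).1 y * ((M (x i)).1 y / (N (x i)).1 y) ^ s :=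
        (Fintype.prod_sum fun i y => (M (x i)).1 y * ((M (x i)).1 y / (N (x i)).1 y) ^ s).symm
    _ ≤ ∏ _i : Fin n, g := prod_le_prod
        (fun i _ => sum_nonneg fun y _ =>
          mul_nonneg ((M (x i)).2.1 y) (Real.rpow_nonneg (hr _ _) _))
        fun i _ => hg (x i)
    _ = g ^ n := by simp

/-- For small `s > 0`, the moment of order `s` of the likelihood ratio is at most `2 ^ (s * t)`
for every `t` above the Kullback–Leibler divergence. -/
lemma eventually_moment_le {Y : Type} [Fintype Y] (p q : stdSimplex ℝ Y)
    (hac : ∀ y, q.1 y = 0 → p.1 y = 0) {t : ℝ}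
    (ht : ∑ y, p.1 y * Real.logb 2 (p.1 y / q.1 y) < t) :
    ∀ᶠ s in 𝓝[>] (0 : ℝ), ∑ y, p.1 y * (p.1 y / q.1 y) ^ s ≤ (2 : ℝ) ^ (s * t) := by
  have hterm : ∀ y, HasDerivAt (fun s : ℝ => p.1 y * (p.1 y / q.1 y) ^ s)
      (p.1 y * Real.log (p.1 y / q.1 y)) 0 := by
    intro y
    rcases eq_or_ne (p.1 y) 0 with h | h
    · simpa [h] using hasDerivAt_const (0 : ℝ) (0 : ℝ)
    · have hp : 0 < p.1 y := lt_of_le_of_ne (p.2.1 y) h.symm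
      have hq : 0 < q.1 y := lt_of_le_of_ne (q.2.1 y) fun h' => h (hac y h'.symm)
      have := ((hasDerivAt_id (0 : ℝ)).const_rpow (div_pos hp hq)).const_mul (p.1 y)
      simpa using this
  have hsum := HasDerivAt.fun_sum (u := univ) fun y _ => hterm y
  have hexp : HasDerivAt (fun s : ℝ => (2 : ℝ) ^ (s * t)) (Real.log 2 * t) 0 := by
    have := ((hasDerivAt_id (0 : ℝ)).mul_const t).const_rpow (two_pos (α := ℝ))
    simpa using this
  -- Both sides equal 1 at `s = 0`, so a strictly positive derivative of the difference gives the
  -- inequality for small `s > 0`.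
  have hd := hexp.fun_sub hsum
  have hlog2 : 0 < Real.log 2 := Real.log_pos one_lt_two
  have hpos : 0 < Real.log 2 * t - ∑ y, p.1 y * Real.log (p.1 y / q.1 y) := by
    have h : ∑ y, p.1 y * Real.log (p.1 y / q.1 y)
        = Real.log 2 * ∑ y, p.1 y * Real.logb 2 (p.1 y / q.1 y) := by
      rw [mul_sum]
      refine sum_congr rfl fun y _ => ?_
      rw [Real.logb]
      field_simp
    rw [h, ← mul_sub]
    exact mul_pos hlog2 (sub_pos.2 ht)
  have hslope := hd.tendsto_slope.mono_left
    (nhdsWithin_mono (0 : ℝ) fun s (hs : s ∈ Set.Ioi 0) => ne_of_gt hs)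
  filter_upwards [hslope.eventually (lt_mem_nhds hpos), self_mem_nhdsWithin] with s hs hs0
  have hs0 : 0 < s := hs0
  have hz : (2 : ℝ) ^ ((0 : ℝ) * t) - ∑ y, p.1 y * (p.1 y / q.1 y) ^ (0 : ℝ) = 0 := by
    simp [p.2.2]
  rw [slope_def_field, hz, sub_zero, sub_zero] at hs
  exact (sub_pos.1 ((div_pos_iff_of_pos_right hs0).1 hs)).le

lemma exists_forall_le_mul {X Y : Type} [Fintype X] [Fintype Y] (M N : Channel X Y)
    (hac : ∀ x y, (N x).1 y = 0 → (M x).1 y = 0) :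
    ∃ b : ℝ, 1 ≤ b ∧ ∀ x y, (M x).1 y ≤ b * (N x).1 y := by
  have hr : ∀ x y, 0 ≤ (M x).1 y / (N x).1 y := fun x y => div_nonneg ((M x).2.1 y) ((N x).2.1 y)
  refine ⟨1 + ∑ x, ∑ y, (M x).1 y / (N x).1 y,
    le_add_of_nonneg_right (sum_nonneg fun x _ => sum_nonneg fun y _ => hr x y), fun x y => ?_⟩
  have h : (M x).1 y / (N x).1 y ≤ 1 + ∑ x, ∑ y, (M x).1 y / (N x).1 y := by
    have h1 := single_le_sum (fun y _ => hr x y) (mem_univ y)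
    have h2 := single_le_sum (f := fun x => ∑ y, (M x).1 y / (N x).1 y)
      (fun x _ => sum_nonneg fun y _ => hr x y) (mem_univ x)
    linarith
  rcases (N x).2.1 y |>.eq_or_lt with h0 | h0
  · rw [hac x y h0.symm, ← h0, mul_zero]
  · exact (div_le_iff₀ h0).1 h

/-! ### Asymptotics of tensor powers -/

/-- A weakly additive channel divergence that extends the Kullback–Leibler divergence is at most
any strict upper bound on the divergences of the outputs. -/
lemma IsChannelDivergence.le_of_forall_lt {D : ChannelFunction} (hdiv : IsChannelDivergence D)
    (hadd : IsWeaklyAdditive D) (hKL : ReducesToKL D) {X Y : Type} [Fintype X] [Nonempty X]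
    [Fintype Y] [Nonempty Y] (M N : Channel X Y)
    (hac : ∀ x y, (N x).1 y = 0 → (M x).1 y = 0) {t : ℝ}
    (ht : ∀ x, ∑ y, (M x).1 y * Real.logb 2 ((M x).1 y / (N x).1 y) < t) :
    D X Y M N ≤ t := by
  obtain ⟨b, hb1, hb⟩ := exists_forall_le_mul M N hac
  have hb0 : 0 < b := by linarith
  have hpow : ∀ (n : ℕ) (x : Fin n → X) (y : Fin n → Y),
      (tensorPower M n x).1 y ≤ b ^ n * (tensorPower N n x).1 y := by
    intro n x y
    change ∏ i, (M (x i)).1 (y i) ≤ b ^ n * ∏ i, (N (x i)).1 (y i)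
    calc ∏ i, (M (x i)).1 (y i) ≤ ∏ i, (b * (N (x i)).1 (y i)) :=
          prod_le_prod (fun i _ => (M (x i)).2.1 _) fun i _ => hb _ _
      _ = b ^ n * ∏ i, (N (x i)).1 (y i) := by simp [prod_mul_distrib]
  -- Finiteness of `X` gives one exponent `s` for all inputs.
  obtain ⟨s, hmom, hs⟩ := ((eventually_all.2 fun x =>
    eventually_moment_le (M x) (N x) (hac x) (ht x)).and self_mem_nhdsWithin).exists
  have hs : 0 < s := hs
  -- With `c = 2 ^ (n (t + δ))` the Chernoff bound is `2 ^ (-n s δ)`, eventually below `ε`.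
  have key : ∀ δ : ℝ, 0 < δ → ∀ ε : ℝ, 0 < ε → ε ≤ 1 / 2 → ∀ᶠ n : ℕ in atTop,
      (n : EReal) * D X Y M N ≤
        ((3 + n * (t + δ) + ε * (2 + n * Real.logb 2 b) : ℝ) : EReal) := by
    intro δ hδ ε hε hε1
    have hlt : (2 : ℝ) ^ (-(s * δ)) < 1 :=
      Real.rpow_lt_one_of_one_lt_of_neg one_lt_two (by nlinarith)
    have hlim := tendsto_pow_atTop_nhds_zero_of_lt_one (by positivity) hlt
    filter_upwards [hlim.eventually (gt_mem_nhds hε), eventually_ge_atTop 1] with n hn hn1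
    rw [← hadd X Y M N n hn1]
    have hc : (0 : ℝ) < 2 ^ (n * (t + δ)) := by positivity
    have hbn : 0 < b ^ n := by positivity
    refine (hdiv.le_of_tail hKL (tensorPower M n) (tensorPower N n) hε hε1 hbn hc
      (hpow n) fun x => ?_).trans (le_of_eq ?_)
    · refine (tail_tensorPower_le M N hac hs hc hmom n x).trans (le_of_eq_of_le ?_ hn.le)
      rw [← Real.rpow_natCast, ← Real.rpow_natCast, ← Real.rpow_mul two_pos.le,
        ← Real.rpow_mul two_pos.le, ← Real.rpow_mul two_pos.le, ← Real.rpow_sub two_pos]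
      congr 1
      ring
    · congr 1
      have h8 : Real.logb 2 8 = 3 := by
        rw [show (8 : ℝ) = 2 ^ (3 : ℝ) by norm_num, Real.logb_rpow two_pos (by norm_num)]
      have h4 : Real.logb 2 4 = 2 := by
        rw [show (4 : ℝ) = 2 ^ (2 : ℝ) by norm_num, Real.logb_rpow two_pos (by norm_num)]
      rw [Real.logb_mul (by norm_num) hc.ne', Real.logb_mul (by norm_num) hbn.ne',
        Real.logb_rpow two_pos (by norm_num), Real.logb_pow, h8, h4]
  have hbot := hdiv.ne_bot X Y M N
  have htop : D X Y M N ≠ ⊤ := by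
    intro h
    obtain ⟨n, hn, hn1⟩ :=
      ((key 1 one_pos (1 / 2) (by norm_num) le_rfl).and (eventually_ge_atTop 1)).exists
    rw [h, EReal.mul_top_of_pos (by exact_mod_cast hn1), top_le_iff] at hn
    exact EReal.coe_ne_top _ hn
  lift D X Y M N to ℝ using ⟨htop, hbot⟩ with v
  rw [EReal.coe_le_coe_iff]
  have hlogb : 0 ≤ Real.logb 2 b := Real.logb_nonneg one_lt_two hb1
  have hv : ∀ δ : ℝ, 0 < δ → ∀ ε : ℝ, 0 < ε → ε ≤ 1 / 2 → v ≤ t + δ + ε * Real.logb 2 b := by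
    intro δ hδ ε hε hε1
    have hlim : Tendsto (fun n : ℕ => (3 + ε * 2) / (n : ℝ) + (t + δ + ε * Real.logb 2 b)) atTop
        (𝓝 (0 + (t + δ + ε * Real.logb 2 b))) :=
      (tendsto_const_div_atTop_nhds_zero_nat _).add_const _
    rw [zero_add] at hlim
    refine ge_of_tendsto hlim ?_
    filter_upwards [key δ hδ ε hε hε1, eventually_ge_atTop 1] with n hn hn1
    have hn0 : (0 : ℝ) < n := by exact_mod_cast hn1
    have hn' : (n : ℝ) * v ≤ 3 + n * (t + δ) + ε * (2 + n * Real.logb 2 b) := by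
      exact_mod_cast hn
    have h : v ≤ (3 + n * (t + δ) + ε * (2 + n * Real.logb 2 b)) / n := by
      rw [le_div_iff₀ hn0]; linarith
    refine h.trans (le_of_eq ?_)
    field_simp
    ring
  refine le_of_forall_pos_le_add fun η hη => ?_
  have hden : 0 < 2 * (Real.logb 2 b + η) := by positivity
  -- This `ε` is at most `1 / 2` and satisfies `ε log₂ b ≤ η / 2`; adding `η` keeps the denominator
  -- nonzero when `b = 1`.
  refine (hv (η / 2) (by positivity) (η / (2 * (Real.logb 2 b + η))) (by positivity) ?_).trans ?_
  · rw [div_le_div_iff₀ hden two_pos]; linarith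
  · have : η / (2 * (Real.logb 2 b + η)) * Real.logb 2 b ≤ η / 2 := by
      rw [div_mul_eq_mul_div, div_le_div_iff₀ hden two_pos]; nlinarith
    linarith

end ClassicalChannel

theorem theorem3 (D : ClassicalChannel.ChannelFunction)
    (hdiv : ClassicalChannel.IsChannelDivergence D)
    (hadd : ClassicalChannel.IsWeaklyAdditive D)
    (hKL : ClassicalChannel.ReducesToKL D)
    (hcont : ClassicalChannel.IsContinuousInSecond D)
    (X Y : Type) [Fintype X] [Nonempty X] [Fintype Y] [Nonempty Y]
    (M N : ClassicalChannel.Channel X Y) :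
    D X Y M N = Finset.univ.sup' Finset.univ_nonempty
      (fun x : X => ClassicalChannel.klDivergence (M x) (N x)) := by
  refine le_antisymm ?_ (Finset.sup'_le _ _ fun x _ => hdiv.klDivergence_le hKL M N x)
  by_cases hac : ∀ x y, (N x).1 y = 0 → (M x).1 y = 0
  · have hkl : ∀ x, ClassicalChannel.klDivergence (M x) (N x)
        = ((∑ y, (M x).1 y * Real.logb 2 ((M x).1 y / (N x).1 y) : ℝ) : EReal) :=
      fun x => if_pos (hac x)
    refine EReal.le_of_forall_lt_iff_le.1 fun t ht => ?_
    refine hdiv.le_of_forall_lt hadd hKL M N hac fun x => ?_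
    have h := (Finset.le_sup' (fun x => ClassicalChannel.klDivergence (M x) (N x))
      (Finset.mem_univ x)).trans_lt ht
    rw [hkl] at h
    exact EReal.coe_lt_coe_iff.1 h
  -- One output pair has infinite divergence, so the maximum is `⊤`.
  · push Not at hac
    obtain ⟨x, y, hN, hM⟩ := hac
    refine le_trans le_top (le_trans (le_of_eq ?_) (Finset.le_sup' _ (Finset.mem_univ x)))
    exact (if_neg fun h => hM (h y hN)).symm
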